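/- **Setting.** Let $R_1$, $R_2$ be maximal-length binary LFSRs of lengths $L_1$, $L_2$ (nonzero initial states, output sequences $\{a_t\}$, $\{b_t\}$ of least periods $2^{L_1}-1$ and $2^{L_2}-1$), and let $A_i(t)=a_{t+i}$, $0\le i<L_1$, be the content of cell $i$ of $R_1$ at time $t$. Choose $w$ distinct cells $i_0,\dots,i_{w-1}$ of $R_1$ ($0\le w\le L_1$; for $w=0$ this is the shrinking generator) and put $$X_t=1+\sum_{k=0}^{w-1}2^kA_{i_k}(t),\qquad S_t=\sum_{s<t}X_s,\qquad b'_t=b_{S_t}.$$ The clock-controlled shrinking generator (CCSG) outputs $c_j=b'_{t_j}$, where $t_0<t_1<\cdots$ are the times $t$ with $a_t=1$. The characteristic polynomial of a sequence $\{c_j\}$ over $GF(2)$ is the monic polynomial $\sum_i p_ix^i$ of least degree such that $\sum_i p_i c_{n+i}=0$ for all $n\ge 0$; its degree is the linear complexity of the sequence. Let $D=(1+2^w)2^{L_1-1}-1$ (the number of clock pulses of $R_2$ in one period of $R_1$). Assume that 1. the cyclotomic coset of $D$ modulo $2^{L_2}-1$ has $L_2$ elements, that is, $2^kD\not\equiv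 D \pmod{2^{L_2}-1}$ for $0<k<L_2$ (this holds for instance if $\gcd(D,2^{L_2}-1)=1$); 2. between two consecutive output bits $R_2$ is clocked at most one full period, that is, $S_{t_{j+1}}-S_{t_j}\le 2^{L_2}-1$ for all $j$ (this holds for instance if $L_1 2^w\le 2^{L_2}-1$). **Lemma.** The characteristic polynomial of the output sequence $\{c_j\}$ of the CCSG is of the form $P'(x)^N$, where $P'(x)\in GF(2)[x]$ is a polynomial of degree $L_2$ and $N$ is an integer with $$2^{L_1-2}<N\le 2^{L_1-1}.$$ -/

import Mathlib

open Polynomial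

/-- A binary linear feedback shift register: a linear recurrence over `GF(2)` whose order is the
length of the register, together with the initial contents of its cells. -/
structure LFSR extends LinearRecurrence (ZMod 2) where
  init : Fin order → ZMod 2

namespace LFSR

/-- The number of cells. -/
def length (R : LFSR) : ℕ := R.order

/-- The output sequence: its first `length` terms are the initial contents, and then it follows
the recurrence. -/
def seq (R : LFSR) : ℕ → ZMod 2 := R.toLinearRecurrence.mkSol R.init

/-- The content of cell `i` at time `t`. Cell `0` holds the current output bit, and at each clock
pulse every cell passes its content to the cell before it, while the last cell receives
the feedback bit. -/
def cell (R : LFSR) (t : ℕ) (i : Fin R.length) : ZMod 2 := R.seq (t + i)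

/-- Maximal-length register (its output is a PN-sequence): the initial state is not zero and the
least period of the output sequence is `2 ^ L - 1`. -/
def IsMaximalLength (R : LFSR) : Prop :=
  R.init ≠ 0 ∧ IsLeast {m : ℕ | 0 < m ∧ ∀ n, R.seq (n + m) = R.seq n} (2 ^ R.length - 1)

end LFSR

/-- A clock-controlled shrinking generator: a control register `R₁`, a second register `R₂`, and
`w` distinct cells of `R₁`, listed as `cells 0, …, cells (w - 1)`, that drive the clock of `R₂`. -/
structure CCSG where
  R₁ : LFSR
  R₂ : LFSR
  w : ℕ
  cells : Fin w ↪ Fin R₁.length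

namespace CCSG

/-- The decimation function `X_t = 1 + 2^0 A_{i_0}(t) + ⋯ + 2^(w-1) A_{i_{w-1}}(t)`. -/
def X (G : CCSG) (t : ℕ) : ℕ := 1 + ∑ k : Fin G.w, 2 ^ (k : ℕ) * (G.R₁.cell t (G.cells k)).val

/-- The number of clock pulses that `R₂` has received before time `t`. -/
def clock (G : CCSG) (t : ℕ) : ℕ := ∑ s ∈ Finset.range t, G.X s

/-- The sequence `b'`, the output of `R₂` decimated by means of `X`. -/
def decimated (G : CCSG) (t : ℕ) : ZMod 2 := G.R₂.seq (G.clock t)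

/-- The time of the `j`-th `1` (counted from `j = 0`) in the output of `R₁`. -/
noncomputable def outTime (G : CCSG) (j : ℕ) : ℕ := Nat.nth (fun t => G.R₁.seq t = 1) j

/-- The output sequence: `b'_t` is kept when `a_t = 1` and discarded when `a_t = 0`. -/
noncomputable def output (G : CCSG) (j : ℕ) : ZMod 2 := G.decimated (G.outTime j)

/-- `D = (1 + 2^w) 2^(L₁-1) - 1`, the number of clock pulses of `R₂` during one period of a
maximal-length register `R₁`. -/
def D (G : CCSG) : ℕ := (1 + 2 ^ G.w) * 2 ^ (G.R₁.length - 1) - 1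

end CCSG

/-- The sequence `c` satisfies the linear recurrence with coefficients those of `p`:
`∑ i, p_i c_{n+i} = 0` for all `n`. -/
def Annihilates (p : (ZMod 2)[X]) (c : ℕ → ZMod 2) : Prop :=
  ∀ n, p.sum (fun i a => a * c (n + i)) = 0

/-- `p` is the characteristic polynomial of the sequence `c`, that of the shortest linear
recurrence satisfied by `c`; its degree is the linear complexity of `c`. -/
def IsCharacteristicPolynomial (p : (ZMod 2)[X]) (c : ℕ → ZMod 2) : Prop :=
  p.Monic ∧ Annihilates p c ∧
    ∀ q : (ZMod 2)[X], q ≠ 0 → Annihilates q c → p.natDegree ≤ q.natDegree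

/-! Write `b_t = φ(α ^ t)` with `α` primitive in the field of `2 ^ L₂` elements and `φ` linear. One
period of `R₁` gives `K = 2 ^ (L₁ - 1)` output bits and `D` pulses, so with `β = α ^ D` every
decimation `i ↦ c (j + i * K)` is `φ(α ^ S * β ^ i)`, where `S` is the pulse count at bit `j`. The
minimal polynomial `P` of `β`, of degree `L₂` by the coset hypothesis, annihilates it. In
characteristic 2, `P(x ^ K) = P(x) ^ K`, hence `P ^ K` annihilates `c` and the characteristic
polynomial is `P ^ N` with `N ≤ K`.

If `N ≤ H = K / 2`, then `P` annihilates every decimation by `H`. This forces `α ^ pulses (j + H) =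
γ * α ^ pulses j` with `γ ^ 2 = β`, for all `j` (`eq_mul_sqrt_of_annihilates`). Since gaps between
output bits are at most one period of `R₂`, they repeat with period `H` (`pulses_gap_of_pow_eq`), so
`D` is twice the number of pulses in half a period. But `D` is odd (`not_pulses_gap_periodic`). -/

namespace LFSR

/-! ### Maximal-length sequences as linear images of powers of a primitive element -/

variable (R : LFSR)

theorem isSolution_of_root {A : Type*} [CommRing A] [Algebra (ZMod 2) A] {α : A}
    (hα : aeval α R.charPoly = 0) (φ : A →ₗ[ZMod 2] ZMod 2) :
    R.IsSolution fun t => φ (α ^ t) := by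
  intro n
  have h : α ^ R.order = ∑ i : Fin R.order, R.coeffs i • α ^ (i : ℕ) := by
    have := hα
    rw [LinearRecurrence.charPoly, map_sub, map_sum, sub_eq_zero] at this
    simpa [aeval_monomial, Algebra.smul_def] using this
  simp only [pow_add, h, Finset.mul_sum, map_sum, mul_smul_comm, map_smul, smul_eq_mul]

theorem natDegree_charPoly : R.charPoly.natDegree = R.order :=
  natDegree_eq_of_degree_eq_some R.charPoly_degree_eq_order

theorem exists_functional_adjoinRoot :
    ∃ φ : AdjoinRoot R.charPoly →ₗ[ZMod 2] ZMod 2,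
      ∀ t, R.seq t = φ (AdjoinRoot.root R.charPoly ^ t) := by
  have hm : R.charPoly.Monic := R.charPoly_monic
  set pb := AdjoinRoot.powerBasis' hm with hpb
  have hdim : pb.dim = R.order := by
    rw [hpb, AdjoinRoot.powerBasis'_dim, natDegree_charPoly]
  let φ := pb.basis.constr (ZMod 2) fun i => R.init (Fin.cast hdim i)
  refine ⟨φ, fun t => ?_⟩
  refine (R.eq_mk_of_is_sol_of_eq_init (R.isSolution_of_root (by simp) φ) (fun n => ?_) t).symm
  have := pb.basis.constr_basis (ZMod 2) (fun i => R.init (Fin.cast hdim i)) (Fin.cast hdim.symm n)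
  rw [pb.basis_eq_pow] at this
  simpa [φ, hpb] using this

variable {R}

theorem IsMaximalLength.length_pos (h : R.IsMaximalLength) : 0 < R.length := by
  rcases Nat.eq_zero_or_pos R.length with h0 | h0
  · exact absurd (_root_.funext fun i : Fin R.order => absurd i.2
      (Nat.not_lt.mpr (h0.le.trans (Nat.zero_le _)))) h.1
  · exact h0

theorem IsMaximalLength.period_pos (h : R.IsMaximalLength) : 0 < 2 ^ R.length - 1 := h.2.1.1

theorem IsMaximalLength.seq_add_period_mul (h : R.IsMaximalLength) (n k : ℕ) :
    R.seq (n + (2 ^ R.length - 1) * k) = R.seq n := by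
  induction k with
  | zero => rfl
  | succ k ih => rw [mul_add, mul_one, ← add_assoc, h.2.1.2, ih]

theorem IsMaximalLength.period_dvd (h : R.IsMaximalLength) {m : ℕ}
    (hm : ∀ n, R.seq (n + m) = R.seq n) : 2 ^ R.length - 1 ∣ m := by
  by_contra hd
  have hpos := Nat.pos_of_ne_zero (fun h0 => hd (Nat.dvd_of_mod_eq_zero h0))
  have hlt := Nat.mod_lt m h.period_pos
  refine absurd (h.2.2 ⟨hpos, fun n => ?_⟩) (not_le.mpr hlt)
  rw [← h.seq_add_period_mul _ (m / (2 ^ R.length - 1)), add_assoc, Nat.mod_add_div, hm]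

theorem IsMaximalLength.exists_seq_ne_zero (h : R.IsMaximalLength) : ∃ t, R.seq t ≠ 0 := by
  by_contra! h0
  exact h.1 (_root_.funext fun i => by simpa using (R.mkSol_eq_init R.init i).symm.trans (h0 i))

/-- Invertibility of `α` is not available here: shifting the index by a multiple of the period makes
room for the factor `α ^ i`, which is then exchanged for `α ^ j`. -/
theorem IsMaximalLength.period_dvd_sub_of_pow_eq (h : R.IsMaximalLength) {A : Type*} [CommRing A]
    {α : A} {φ : A → ZMod 2} (hφ : ∀ t, R.seq t = φ (α ^ t)) {i j : ℕ} (hij : i ≤ j)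
    (he : α ^ i = α ^ j) : 2 ^ R.length - 1 ∣ j - i := by
  refine h.period_dvd fun n => ?_
  have hi : i ≤ (2 ^ R.length - 1) * i := Nat.le_mul_of_pos_left _ h.period_pos
  rw [← h.seq_add_period_mul _ i, ← h.seq_add_period_mul n i, hφ, hφ]
  obtain ⟨c, hc⟩ := Nat.exists_eq_add_of_le hi
  rw [show n + (j - i) + (2 ^ R.length - 1) * i = n + c + j by omega,
    show n + (2 ^ R.length - 1) * i = n + c + i by omega, pow_add, pow_add _ _ i, he]

/-- Irreducibility is a consequence of the period: the first `2 ^ L - 1` powers of the root are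
distinct and nonzero, so they exhaust the nonzero elements of the quotient ring, which is therefore
a field. -/
theorem IsMaximalLength.exists_field (h : R.IsMaximalLength) :
    ∃ (A : Type) (_ : Field A) (_ : Fintype A) (_ : Algebra (ZMod 2) A) (α : A)
      (φ : A →ₗ[ZMod 2] ZMod 2), Fintype.card A = 2 ^ R.length ∧
      orderOf α = 2 ^ R.length - 1 ∧ φ ≠ 0 ∧ ∀ t, R.seq t = φ (α ^ t) := by
  classical
  obtain ⟨f, hm, hf, φ, hφ⟩ : ∃ f : (ZMod 2)[X], f.Monic ∧ f.natDegree = R.length ∧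
      ∃ φ : AdjoinRoot f →ₗ[ZMod 2] ZMod 2, ∀ t, R.seq t = φ (AdjoinRoot.root f ^ t) :=
    ⟨_, R.charPoly_monic, R.natDegree_charPoly, R.exists_functional_adjoinRoot⟩
  set α := AdjoinRoot.root f with hα
  let pb := AdjoinRoot.powerBasis' hm
  have hdim : pb.dim = R.length := by
    simp only [pb, AdjoinRoot.powerBasis'_dim, hf]
  let _ : Fintype (AdjoinRoot f) := Fintype.ofEquiv _ pb.basis.equivFun.symm.toEquiv
  have hcard : Fintype.card (AdjoinRoot f) = 2 ^ R.length := by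
    rw [Module.card_fintype pb.basis]
    simp [hdim, ZMod.card]
  have hM := h.period_pos
  set M := 2 ^ R.length - 1 with hMdef
  have hinj : ∀ {i j}, i ≤ j → α ^ i = α ^ j → M ∣ j - i := fun hij he =>
    h.period_dvd_sub_of_pow_eq hφ hij he
  have hne : ∀ i, α ^ i ≠ 0 := by
    intro i hi
    obtain ⟨t, ht⟩ := h.exists_seq_ne_zero
    apply ht
    rw [← h.seq_add_period_mul t i, hφ,
      show t + (2 ^ R.length - 1) * i = t + (M * i - i) + i by
        have : i ≤ M * i := Nat.le_mul_of_pos_left _ hM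
        rw [← hMdef]; omega, pow_add, hi, mul_zero, map_zero]
  have hsurj : ∀ y : AdjoinRoot f, y ≠ 0 → ∃ i < M, α ^ i = y := by
    intro y hy
    have hinj' : Set.InjOn (fun i => α ^ i) (Finset.range M : Set ℕ) := by
      intro i hi j hj he
      simp only [Finset.coe_range, Set.mem_Iio] at hi hj
      rcases le_total i j with hij | hij
      · have := Nat.eq_zero_of_dvd_of_lt (hinj hij he) (by omega); omega
      · have := Nat.eq_zero_of_dvd_of_lt (hinj hij he.symm) (by omega); omega
    have : (Finset.range M).image (fun i => α ^ i) = Finset.univ.erase 0 := by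
      apply Finset.eq_of_subset_of_card_le
      · intro z hz
        obtain ⟨i, -, rfl⟩ := Finset.mem_image.mp hz
        simp [hne]
      · rw [Finset.card_image_of_injOn hinj', Finset.card_erase_of_mem (Finset.mem_univ _),
          Finset.card_univ, hcard, Finset.card_range]
    have hy' : y ∈ (Finset.range M).image (fun i => α ^ i) := by rw [this]; simp [hy]
    simpa using hy'
  have hone : α ^ M = 1 := by
    obtain ⟨i, hi, he⟩ := hsurj _ (hne M)
    have h1 := Nat.le_of_dvd (by omega) (hinj hi.le he)
    obtain rfl : i = 0 := by omega
    simpa using he.symm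
  have hord : orderOf α = M := by
    apply Nat.dvd_antisymm (orderOf_dvd_of_pow_eq_one hone)
    simpa using hinj (Nat.zero_le (orderOf α)) (by simp [pow_orderOf_eq_one])
  have hfield : IsField (AdjoinRoot f) := by
    refine ⟨⟨0, 1, fun h0 => hne 0 (by simp [h0.symm])⟩, mul_comm, fun {y} hy => ?_⟩
    obtain ⟨i, hi, rfl⟩ := hsurj y hy
    exact ⟨α ^ (M - i), by rw [← pow_add, Nat.add_sub_cancel' hi.le, hone]⟩
  have hirr : Irreducible f := by
    have hmax := Ideal.Quotient.maximal_of_isField _ hfield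
    exact (Ideal.span_singleton_prime hm.ne_zero).mp hmax.isPrime |>.irreducible
  have : Fact (Irreducible f) := ⟨hirr⟩
  refine ⟨AdjoinRoot f, inferInstance, inferInstance, inferInstance, α, φ, hcard, hord, ?_, hφ⟩
  rintro rfl
  obtain ⟨t, ht⟩ := h.exists_seq_ne_zero
  exact ht (by simpa using hφ t)

/-- A maximal-length register outputs `2 ^ (L - 1)` ones in each period. -/
theorem IsMaximalLength.sum_val_seq (h : R.IsMaximalLength) (s : ℕ) :
    ∑ t ∈ Finset.range (2 ^ R.length - 1), (R.seq (s + t)).val = 2 ^ (R.length - 1) := by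
  classical
  obtain ⟨A, _, _, _, α, φ, hcard, hord, hφ0, hφ⟩ := h.exists_field
  have hM := h.period_pos
  have hα : α ≠ 0 := by
    rintro rfl
    have := pow_orderOf_eq_one (0 : A)
    rw [hord, zero_pow hM.ne'] at this
    exact zero_ne_one this
  obtain ⟨z, hz⟩ : ∃ z, φ z = 1 := by
    by_contra! hz
    refine hφ0 (LinearMap.ext fun y => ?_)
    have hdec : ∀ a : ZMod 2, a ≠ 1 → a = 0 := by decide
    exact hdec _ (hz y)
  have h1 : ∑ t ∈ Finset.range (2 ^ R.length - 1), (R.seq (s + t)).val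
      = ∑ y ∈ Finset.univ.erase (0 : A), (φ y).val := by
    have himg : (Finset.range (2 ^ R.length - 1)).image (fun t => α ^ (s + t))
        = Finset.univ.erase 0 := by
      apply Finset.eq_of_subset_of_card_le
      · intro z hz
        obtain ⟨i, -, rfl⟩ := Finset.mem_image.mp hz
        simp [hα]
      · rw [Finset.card_image_of_injOn, Finset.card_erase_of_mem (Finset.mem_univ _),
          Finset.card_univ, hcard, Finset.card_range]
        intro i hi j hj he
        simp only [pow_add] at he
        exact pow_injOn_Iio_orderOf (by simpa [hord] using hi) (by simpa [hord] using hj)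
          (mul_left_cancel₀ (pow_ne_zero _ hα) he)
    rw [← himg, Finset.sum_image]
    · simp only [hφ]
    · intro i hi j hj he
      simp only [pow_add] at he
      exact pow_injOn_Iio_orderOf (by simpa [hord] using hi) (by simpa [hord] using hj)
          (mul_left_cancel₀ (pow_ne_zero _ hα) he)
  have h2 : ∑ y ∈ Finset.univ.erase (0 : A), (φ y).val = ∑ y, (φ y).val :=
    Finset.sum_erase _ (by simp)
  -- Translation by `z` exchanges the values 0 and 1 of `φ`, so each is taken by half of the field.
  have h3 : ∑ y, (φ (y + z)).val = ∑ y, (φ y).val :=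
    Equiv.sum_comp (Equiv.addRight z) fun y => (φ y).val
  have h4 : ∑ y, ((φ y).val + (φ (y + z)).val) = 2 ^ R.length := by
    rw [← hcard, Fintype.card_eq_sum_ones]
    refine Finset.sum_congr rfl fun y _ => ?_
    rw [map_add, hz]
    generalize φ y = a
    revert a; decide
  rw [Finset.sum_add_distrib, h3] at h4
  have h5 : 2 ^ R.length = 2 * 2 ^ (R.length - 1) := by
    rw [← pow_succ', Nat.sub_add_cancel h.length_pos]
  rw [h1, h2]
  omega

end LFSR

/-! ### Clock pulses during a period of the control register -/

namespace CCSG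

variable {G : CCSG}

/-- Each cell carries a shift of the output of `R₁`, hence `2 ^ (L₁ - 1)` ones per period; the
weights `2 ^ k` add up to `2 ^ w - 1`. -/
theorem sum_X (h₁ : G.R₁.IsMaximalLength) (t : ℕ) :
    ∑ s ∈ Finset.range (2 ^ G.R₁.length - 1), G.X (t + s) = G.D := by
  have hcell : ∀ k : Fin G.w, ∑ s ∈ Finset.range (2 ^ G.R₁.length - 1),
      (G.R₁.cell (t + s) (G.cells k)).val = 2 ^ (G.R₁.length - 1) := by
    intro k
    rw [← h₁.sum_val_seq (t + G.cells k)]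
    refine Finset.sum_congr rfl fun s _ => ?_
    rw [LFSR.cell, add_right_comm]
  have hgeom : ∑ k : Fin G.w, 2 ^ (k : ℕ) = 2 ^ G.w - 1 := by
    rw [Fin.sum_univ_eq_sum_range (fun k => 2 ^ k), Nat.geomSum_eq le_rfl, Nat.div_one]
  simp only [X, Finset.sum_add_distrib]
  rw [Finset.sum_comm]
  simp only [← Finset.mul_sum, hcell, ← Finset.sum_mul, hgeom]
  have h5 : 2 ^ G.R₁.length = 2 * 2 ^ (G.R₁.length - 1) := by
    rw [← pow_succ', Nat.sub_add_cancel h₁.length_pos]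
  have hw : 1 ≤ 2 ^ G.w := Nat.one_le_two_pow
  have hK : 1 ≤ 2 ^ (G.R₁.length - 1) := Nat.one_le_two_pow
  obtain ⟨u, hu⟩ := Nat.exists_eq_add_of_le hw
  simp only [D, hu, Finset.sum_const, Finset.card_range, smul_eq_mul, mul_one, h5]
  rw [Nat.add_sub_cancel_left, add_mul, add_mul, one_mul]
  omega

theorem clock_add_period (h₁ : G.R₁.IsMaximalLength) (t : ℕ) :
    G.clock (t + (2 ^ G.R₁.length - 1)) = G.clock t + G.D := by
  rw [clock, Finset.sum_range_add, sum_X h₁, clock]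

theorem clock_strictMono : StrictMono G.clock :=
  strictMono_nat_of_lt_succ fun t => by
    rw [clock, clock, Finset.sum_range_succ, X]
    omega

theorem count_add_period (h₁ : G.R₁.IsMaximalLength) (t : ℕ) :
    Nat.count (fun t => G.R₁.seq t = 1) (t + (2 ^ G.R₁.length - 1)) =
      Nat.count (fun t => G.R₁.seq t = 1) t + 2 ^ (G.R₁.length - 1) := by
  rw [Nat.count_add, Nat.count_eq_card_filter_range _ (2 ^ _ - 1), Finset.card_filter,
    ← h₁.sum_val_seq t]
  congr 1
  refine Finset.sum_congr rfl fun s _ => ?_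
  generalize G.R₁.seq (t + s) = a
  revert a; decide

theorem infinite_ones (h₁ : G.R₁.IsMaximalLength) :
    (Set.ofPred fun t => G.R₁.seq t = 1).Infinite := by
  have hdec : ∀ a : ZMod 2, a ≠ 0 → a = 1 := by decide
  obtain ⟨t, ht⟩ := h₁.exists_seq_ne_zero
  refine Set.infinite_of_injective_forall_mem
    (f := fun k => t + (2 ^ G.R₁.length - 1) * k) (fun a b hab => ?_) (fun k => ?_)
  · exact Nat.eq_of_mul_eq_mul_left h₁.period_pos (Nat.add_left_cancel hab)
  · change G.R₁.seq _ = 1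
    rw [h₁.seq_add_period_mul]
    exact hdec _ ht

theorem outTime_add (h₁ : G.R₁.IsMaximalLength) (j : ℕ) :
    G.outTime (j + 2 ^ (G.R₁.length - 1)) = G.outTime j + (2 ^ G.R₁.length - 1) := by
  have hj := Nat.nth_mem_of_infinite (infinite_ones h₁) j
  have hp : G.R₁.seq (G.outTime j + (2 ^ G.R₁.length - 1)) = 1 := by
    rw [h₁.2.1.2]; exact hj
  have := Nat.nth_count (p := fun t => G.R₁.seq t = 1) hp
  rwa [count_add_period h₁, outTime, Nat.count_nth_of_infinite (infinite_ones h₁)] at this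

/-- The number of clock pulses received by `R₂` before the `j`-th output bit. -/
noncomputable def pulses (G : CCSG) (j : ℕ) : ℕ := G.clock (G.outTime j)

theorem output_eq_seq_pulses (G : CCSG) (j : ℕ) : G.output j = G.R₂.seq (G.pulses j) := rfl

theorem pulses_add (h₁ : G.R₁.IsMaximalLength) (j : ℕ) :
    G.pulses (j + 2 ^ (G.R₁.length - 1)) = G.pulses j + G.D := by
  rw [pulses, outTime_add h₁, clock_add_period h₁, pulses]

theorem pulses_add_mul (h₁ : G.R₁.IsMaximalLength) (j q : ℕ) :
    G.pulses (j + q * 2 ^ (G.R₁.length - 1)) = G.pulses j + q * G.D := by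
  induction q with
  | zero => simp
  | succ q ih => rw [add_mul, one_mul, ← add_assoc, pulses_add h₁, ih, add_mul, one_mul, add_assoc]

theorem pulses_strictMono (h₁ : G.R₁.IsMaximalLength) : StrictMono G.pulses :=
  clock_strictMono.comp (Nat.nth_strictMono (infinite_ones h₁))

/-- If the register is not of length one, the pulses between output bits do not repeat with
half the period, because an odd number of pulses is received during a full period. -/
theorem not_pulses_gap_periodic (h₁ : G.R₁.IsMaximalLength) {H : ℕ}
    (hH : 2 ^ (G.R₁.length - 1) = 2 * H)
    (h : ∀ j, G.pulses (j + H + 1) - G.pulses (j + H) = G.pulses (j + 1) - G.pulses j) : False := by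
  have hmono := pulses_strictMono h₁
  -- Equal gaps make `pulses (j + H) - pulses j` constant; at `j = H` this gives that `D` is even.
  have key : ∀ j, G.pulses (j + H) + G.pulses 0 = G.pulses j + G.pulses H := by
    intro j
    induction j with
    | zero => rw [zero_add, add_comm]
    | succ j ih =>
      have h1 := h j
      have h2 := hmono (Nat.lt_succ_self (j + H))
      have h3 := hmono (Nat.lt_succ_self j)
      rw [add_right_comm j 1 H]
      simp only [Nat.succ_eq_add_one] at h2 h3
      omega
  have h1 := key H
  have h2 := pulses_add h₁ 0
  rw [hH, zero_add, two_mul] at h2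
  have hDodd : G.D = (1 + 2 ^ G.w) * (2 * H) - 1 := by rw [D, hH]
  have hHpos : 0 < H := by
    rcases Nat.eq_zero_or_pos H with h0 | h0
    · rw [h0] at hH; exact absurd hH (by positivity)
    · exact h0
  rw [mul_left_comm] at hDodd
  have : 0 < (1 + 2 ^ G.w) * H := by positivity
  omega

end CCSG

/-! ### Annihilating polynomials of a binary sequence -/

/-- The linear functional `p ↦ ∑ i, p_i c_i` on polynomials attached to a sequence `c`. -/
noncomputable def seqFunctional (c : ℕ → ZMod 2) : (ZMod 2)[X] →ₗ[ZMod 2] ZMod 2 :=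
  Polynomial.lsum fun i => LinearMap.mulRight (ZMod 2) (c i)

theorem seqFunctional_apply (c : ℕ → ZMod 2) (p : (ZMod 2)[X]) :
    seqFunctional c p = p.sum fun i a => a * c i := rfl

theorem seqFunctional_X_pow (c : ℕ → ZMod 2) (n : ℕ) : seqFunctional c (X ^ n) = c n := by
  rw [seqFunctional_apply, X_pow_eq_monomial, sum_monomial_index _ (fun i a => a * c i) (zero_mul _),
    one_mul]

theorem linearMap_ext_X_pow {f g : (ZMod 2)[X] →ₗ[ZMod 2] ZMod 2}
    (h : ∀ n, f (X ^ n) = g (X ^ n)) : f = g :=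
  (Polynomial.basisMonomials (ZMod 2)).ext fun n => by
    simpa [X_pow_eq_monomial] using h n

theorem seqFunctional_eq_aeval {A : Type*} [CommRing A] [Algebra (ZMod 2) A]
    (φ : A →ₗ[ZMod 2] ZMod 2) (u v : A) {c : ℕ → ZMod 2} (hc : ∀ n, c n = φ (u * v ^ n))
    (q : (ZMod 2)[X]) : seqFunctional c q = φ (u * aeval v q) := by
  have : seqFunctional c = φ ∘ₗ LinearMap.mulLeft (ZMod 2) u ∘ₗ (aeval v).toLinearMap :=
    linearMap_ext_X_pow fun n => by simp [seqFunctional_X_pow, hc]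
  rw [this]; rfl

theorem seqFunctional_X_pow_mul (c : ℕ → ZMod 2) (n : ℕ) (q : (ZMod 2)[X]) :
    seqFunctional c (X ^ n * q) = seqFunctional (fun i => c (n + i)) q := by
  have : seqFunctional c ∘ₗ LinearMap.mulLeft (ZMod 2) (X ^ n)
      = seqFunctional fun i => c (n + i) :=
    linearMap_ext_X_pow fun m => by simp [← pow_add, seqFunctional_X_pow]
  rw [← this]; rfl

theorem seqFunctional_expand (c : ℕ → ZMod 2) (k : ℕ) (q : (ZMod 2)[X]) :
    seqFunctional c (expand (ZMod 2) k q) = seqFunctional (fun i => c (i * k)) q := by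
  have : seqFunctional c ∘ₗ (expand (ZMod 2) k).toLinearMap = seqFunctional fun i => c (i * k) :=
    linearMap_ext_X_pow fun m => by simp [← pow_mul, seqFunctional_X_pow, mul_comm]
  rw [← this]; rfl

theorem annihilates_iff (p : (ZMod 2)[X]) (c : ℕ → ZMod 2) :
    Annihilates p c ↔ ∀ n, seqFunctional (fun i => c (n + i)) p = 0 := Iff.rfl

theorem annihilates_iff_forall_mul (p : (ZMod 2)[X]) (c : ℕ → ZMod 2) :
    Annihilates p c ↔ ∀ q, seqFunctional c (q * p) = 0 := by
  simp only [annihilates_iff, ← seqFunctional_X_pow_mul]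
  refine ⟨fun h q => ?_, fun h n => h _⟩
  have : seqFunctional c ∘ₗ LinearMap.mulRight (ZMod 2) p = 0 :=
    linearMap_ext_X_pow fun m => by simpa using h m
  exact congrArg (fun f => f q) this

/-- The ideal of the polynomials that annihilate a sequence. -/
def annihilatingIdeal (c : ℕ → ZMod 2) : Ideal (ZMod 2)[X] where
  carrier := {p | Annihilates p c}
  zero_mem' := by simp [annihilates_iff]
  add_mem' {p q} hp hq := by
    simp only [Set.mem_ofPred_eq, annihilates_iff, map_add] at *
    intro n; rw [hp, hq, add_zero]
  smul_mem' r p hp := by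
    simp only [Set.mem_ofPred_eq, annihilates_iff_forall_mul, smul_eq_mul] at *
    intro q; rw [← mul_assoc, hp]

theorem mem_annihilatingIdeal {p : (ZMod 2)[X]} {c : ℕ → ZMod 2} :
    p ∈ annihilatingIdeal c ↔ Annihilates p c := Iff.rfl

/-- A sequence annihilated by a power of a monic irreducible polynomial has a smaller power of it
as its characteristic polynomial. -/
theorem exists_isCharacteristicPolynomial_pow {P : (ZMod 2)[X]} (hm : P.Monic)
    (hP : Irreducible P) {c : ℕ → ZMod 2} {K : ℕ} (h : Annihilates (P ^ K) c) :
    ∃ N ≤ K, IsCharacteristicPolynomial (P ^ N) c := by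
  obtain ⟨g, hg⟩ := (IsPrincipalIdealRing.principal (annihilatingIdeal c)).principal
  have hmem : ∀ q, Annihilates q c ↔ g ∣ q := fun q => by
    rw [← mem_annihilatingIdeal, hg]; exact Ideal.mem_span_singleton
  obtain ⟨N, hN, hgN⟩ := (dvd_prime_pow hP.prime K).mp ((hmem _).mp h)
  refine ⟨N, hN, hm.pow N, (hmem _).mpr hgN.dvd, fun q hq0 hq => ?_⟩
  exact natDegree_le_of_dvd (hgN.dvd_iff_dvd_left.mp ((hmem q).mp hq)) hq0

theorem expand_two_pow (n : ℕ) (p : (ZMod 2)[X]) : expand (ZMod 2) (2 ^ n) p = p ^ 2 ^ n := by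
  induction n with
  | zero => simp
  | succ n ih => rw [pow_succ', expand_mul, ih, map_pow, ZMod.expand_card, pow_mul]

/-- By Frobenius, `p ^ 2 ^ n` is `p` evaluated at `X ^ 2 ^ n`, which acts on each residue class of
indices modulo `2 ^ n` separately. -/
theorem annihilates_pow_two_pow_iff (n : ℕ) (p : (ZMod 2)[X]) (c : ℕ → ZMod 2) :
    Annihilates (p ^ 2 ^ n) c ↔ ∀ j, Annihilates p fun i => c (j + i * 2 ^ n) := by
  rw [annihilates_iff, ← expand_two_pow]
  simp only [seqFunctional_expand, annihilates_iff]
  refine ⟨fun h j m => ?_, fun h j => by simpa using h j 0⟩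
  simpa [add_mul, add_assoc] using h (j + m * 2 ^ n)

/-! ### Conjugates and square roots in a finite field -/

section FiniteField

variable {A : Type*} [Field A] [Algebra (ZMod 2) A]

/-- If `x - y` were invertible, its multiples would fill the field and `φ` would vanish. -/
theorem eq_of_forall_functional {φ : A →ₗ[ZMod 2] ZMod 2} (hφ : φ ≠ 0) {x y : A}
    (h : ∀ z, φ (x * z) = φ (y * z)) : x = y := by
  by_contra hxy
  have hne : x - y ≠ 0 := sub_ne_zero.mpr hxy
  refine hφ (LinearMap.ext fun z => ?_)
  have := h ((x - y)⁻¹ * z)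
  rw [← sub_eq_zero, ← map_sub, ← sub_mul, mul_inv_cancel_left₀ hne] at this
  simpa using this

/-- An element with `L` distinct conjugates generates the field with `2 ^ L` elements. -/
theorem natDegree_minpoly_eq_finrank [Fintype A] {β : A}
    (hβ : ∀ k, 0 < k → k < Module.finrank (ZMod 2) A → β ^ 2 ^ k ≠ β) :
    (minpoly (ZMod 2) β).natDegree = Module.finrank (ZMod 2) A := by
  have hint : IsIntegral (ZMod 2) β := Algebra.IsIntegral.isIntegral β
  have hpos := minpoly.natDegree_pos hint
  refine (minpoly.natDegree_le β).eq_of_not_lt fun hlt => hβ _ hpos hlt ?_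
  -- The subfield generated by `β` has `2 ^ deg` elements, so `β` is fixed by the corresponding
  -- power of Frobenius.
  have hcard : Nat.card (IntermediateField.adjoin (ZMod 2) {β}) =
      2 ^ (minpoly (ZMod 2) β).natDegree := by
    rw [Module.natCard_eq_pow_finrank (K := ZMod 2), Nat.card_zmod,
      IntermediateField.adjoin.finrank hint]
  have := Fintype.ofFinite (IntermediateField.adjoin (ZMod 2) {β})
  rw [Nat.card_eq_fintype_card] at hcard
  have h := FiniteField.pow_card (IntermediateField.AdjoinSimple.gen (ZMod 2) β)
  rw [hcard] at h
  simpa using congrArg (algebraMap _ A) h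

theorem aeval_surjective_of_natDegree_minpoly [Fintype A] {β : A}
    (hβ : (minpoly (ZMod 2) β).natDegree = Module.finrank (ZMod 2) A) :
    Function.Surjective (aeval (R := ZMod 2) β) := by
  have htop := (Field.primitive_element_iff_minpoly_natDegree_eq (ZMod 2) β).mpr hβ
  have h := IntermediateField.adjoin_simple_toSubalgebra_of_isAlgebraic
    (Algebra.IsAlgebraic.isAlgebraic (R := ZMod 2) β)
  rw [htop, IntermediateField.top_toSubalgebra, Algebra.adjoin_singleton_eq_range_aeval] at h
  exact AlgHom.range_eq_top _ |>.mp h.symm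

/-- If a sequence is annihilated by the minimal polynomial of `β`, and its terms of even and of
odd index are `φ (u * β ^ i)` and `φ (v * β ^ i)`, then `v` is `u` times the square root of `β`. -/
theorem eq_mul_sqrt_of_annihilates {φ : A →ₗ[ZMod 2] ZMod 2} (hφ : φ ≠ 0) {β γ u v : A}
    (hsurj : Function.Surjective (aeval (R := ZMod 2) β)) (hγ : γ ^ 2 = β) {d : ℕ → ZMod 2}
    (hd : Annihilates (minpoly (ZMod 2) β) d) (h0 : ∀ i, d (i * 2) = φ (u * β ^ i))
    (h1 : ∀ i, d (1 + i * 2) = φ (v * β ^ i)) : v = u * γ := by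
  rw [annihilates_iff_forall_mul] at hd
  -- The functional of `d` depends only on values at `β`. Squares only involve even indices, and `X`
  -- times a square only odd ones.
  have hcongr : ∀ p q, aeval β p = aeval β q → seqFunctional d p = seqFunctional d q := by
    intro p q hpq
    obtain ⟨r, hr⟩ := minpoly.dvd (ZMod 2) β (p := p - q) (by rw [map_sub, hpq, sub_self])
    rw [← sub_eq_zero, ← map_sub, hr, mul_comm, hd]
  have heven : ∀ q, seqFunctional d (q ^ 2) = φ (u * aeval β q) := fun q => by
    rw [← ZMod.expand_card, seqFunctional_expand]
    exact seqFunctional_eq_aeval φ u β h0 q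
  have hodd : ∀ q, seqFunctional d (X ^ 1 * q ^ 2) = φ (v * aeval β q) := fun q => by
    rw [seqFunctional_X_pow_mul, ← ZMod.expand_card, seqFunctional_expand]
    exact seqFunctional_eq_aeval φ v β h1 q
  -- With `z(β) = γ`, the polynomials `X * q ^ 2` and `(z * q) ^ 2` agree at `β`; the first is read
  -- off the odd terms, the second off the even ones.
  obtain ⟨z, hz⟩ := hsurj γ
  refine eq_of_forall_functional hφ fun y => ?_
  obtain ⟨q, rfl⟩ := hsurj y
  rw [← hodd, hcongr (X ^ 1 * q ^ 2) ((z * q) ^ 2) (by simp [mul_pow, hz, hγ]), heven,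
    map_mul (aeval β), hz, mul_assoc]

end FiniteField

/-! ### The bounds on the exponent -/

theorem CCSG.pulses_gap_of_pow_eq (G : CCSG) (h₁ : G.R₁.IsMaximalLength) {A : Type*} [Field A]
    {α γ : A} (hα : α ≠ 0) (hord : orderOf α = 2 ^ G.R₂.length - 1)
    (hgap : ∀ j, G.pulses (j + 1) - G.pulses j ≤ 2 ^ G.R₂.length - 1) {H : ℕ}
    (h : ∀ j, α ^ G.pulses (j + H) = α ^ G.pulses j * γ) (j : ℕ) :
    G.pulses (j + H + 1) - G.pulses (j + H) = G.pulses (j + 1) - G.pulses j := by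
  have hmono := CCSG.pulses_strictMono h₁
  have h1 := hmono (Nat.lt_add_one (j + H))
  have h2 := hmono (Nat.lt_add_one j)
  have h3 := hgap j
  have h4 := hgap (j + H)
  -- Gaps lie between 1 and the order of `α`, inclusive; lowering them by 1 brings them into the
  -- range where powers of `α` are distinct.
  have hpow : α ^ (G.pulses (j + H + 1) - G.pulses (j + H) - 1) =
      α ^ (G.pulses (j + 1) - G.pulses j - 1) := by
    have e1 := h (j + 1)
    rw [add_right_comm, show G.pulses (j + H + 1) =
      (G.pulses (j + H + 1) - G.pulses (j + H) - 1) + (G.pulses (j + H) + 1) by omega,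
      show G.pulses (j + 1) = (G.pulses (j + 1) - G.pulses j - 1) + (G.pulses j + 1) by omega,
      pow_add, pow_add _ _ (G.pulses j + 1), pow_succ _ (G.pulses (j + H)), pow_succ, h j,
      mul_assoc _ _ γ, mul_right_comm (α ^ G.pulses j) α γ] at e1
    refine mul_right_cancel₀ ?_ e1
    rw [← h j, ← pow_succ]
    exact pow_ne_zero _ hα
  have := pow_injOn_Iio_orderOf (by rw [hord, Set.mem_Iio]; omega)
    (by rw [hord, Set.mem_Iio]; omega) hpow
  omega

theorem lemma4p1 (G : CCSG)
    (h₁ : G.R₁.IsMaximalLength) (h₂ : G.R₂.IsMaximalLength)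
    (hD : ∀ k : ℕ, 0 < k → k < G.R₂.length →
      ¬ 2 ^ k * G.D ≡ G.D [MOD 2 ^ G.R₂.length - 1])
    (hgap : ∀ j : ℕ,
      G.clock (G.outTime (j + 1)) - G.clock (G.outTime j) ≤ 2 ^ G.R₂.length - 1) :
    ∃ (P' : (ZMod 2)[X]) (N : ℕ),
      IsCharacteristicPolynomial (P' ^ N) G.output ∧
      P'.natDegree = G.R₂.length ∧
      (2 : ℝ) ^ ((G.R₁.length : ℤ) - 2) < N ∧
      (N : ℝ) ≤ (2 : ℝ) ^ ((G.R₁.length : ℤ) - 1) := by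
  obtain ⟨A, _, _, _, α, φ, hcard, hord, hφ0, hφ⟩ := h₂.exists_field
  have hα : α ≠ 0 := by
    rintro rfl
    have := pow_orderOf_eq_one (0 : A)
    rw [hord, zero_pow h₂.period_pos.ne'] at this
    exact zero_ne_one this
  have hfin : Module.finrank (ZMod 2) A = G.R₂.length := by
    rw [Module.card_eq_pow_finrank (K := ZMod 2), ZMod.card] at hcard
    exact Nat.pow_right_injective le_rfl hcard
  obtain ⟨l, hl⟩ := Nat.exists_eq_succ_of_ne_zero h₁.length_pos.ne'
  have hK : 2 ^ (G.R₁.length - 1) = 2 ^ l := by rw [hl, Nat.succ_sub_one]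
  set β := α ^ G.D with hβ
  have hint : IsIntegral (ZMod 2) β := Algebra.IsIntegral.isIntegral β
  have hdeg := natDegree_minpoly_eq_finrank (β := β) fun k hk hkL h => by
    refine hD k hk (hfin ▸ hkL) ?_
    rw [hβ, ← pow_mul, mul_comm,
      (orderOf_pos_iff.mp (hord ▸ h₂.period_pos)).pow_eq_pow_iff_modEq, hord] at h
    exact h
  have hsurj := aeval_surjective_of_natDegree_minpoly hdeg
  set P := minpoly (ZMod 2) β with hP
  have hout : ∀ j i, G.output (j + i * 2 ^ l) = φ (α ^ G.pulses j * β ^ i) := fun j i => by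
    rw [CCSG.output_eq_seq_pulses, ← hK, CCSG.pulses_add_mul h₁, hφ, pow_add, hβ, ← pow_mul,
      mul_comm i]
  have hann : Annihilates (P ^ 2 ^ l) G.output := by
    rw [annihilates_pow_two_pow_iff]
    intro j
    rw [annihilates_iff_forall_mul]
    intro q
    rw [seqFunctional_eq_aeval φ _ β (hout j), map_mul (aeval β), hP, minpoly.aeval, mul_zero,
      mul_zero, map_zero]
  obtain ⟨N, hN, hchar⟩ := exists_isCharacteristicPolynomial_pow (minpoly.monic hint)
    (minpoly.irreducible hint) hann
  -- This is the whole lower bound when `L₁ = 1`. For `N = 0` the output would vanish, and with it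
  -- `φ` on all multiples of a nonzero element.
  have hNpos : 0 < N := by
    refine Nat.pos_of_ne_zero ?_
    rintro rfl
    have h := hchar.2.1
    rw [pow_zero, annihilates_iff] at h
    refine pow_ne_zero (G.pulses 0) hα (eq_of_forall_functional hφ0 fun z => ?_)
    obtain ⟨q, rfl⟩ := hsurj z
    rw [zero_mul, map_zero, ← seqFunctional_eq_aeval φ _ β (hout 0)]
    have hzero : ∀ n, G.output n = 0 := fun n => by
      rw [← add_zero n, ← seqFunctional_X_pow (fun i => G.output (n + i)) 0, pow_zero, h n]
    simp [seqFunctional_apply, hzero, Polynomial.sum]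
  refine ⟨P, N, hchar, hdeg.trans hfin, ?_, ?_⟩
  · rw [hl]
    rcases l with _ | m
    · have : (1 : ℝ) ≤ N := by exact_mod_cast hNpos
      refine lt_of_lt_of_le ?_ this
      norm_num
    · have hcast : ((m + 1 + 1 : ℕ) : ℤ) - 2 = (m : ℕ) := by push_cast; ring
      rw [Nat.succ_eq_add_one, hcast, zpow_natCast]
      by_contra hcon
      have hle : N ≤ 2 ^ m := by exact_mod_cast not_lt.mp hcon
      have hhalf : Annihilates (P ^ 2 ^ m) G.output := by
        rw [← mem_annihilatingIdeal, ← Nat.sub_add_cancel hle, pow_add]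
        exact Ideal.mul_mem_left _ _ (mem_annihilatingIdeal.mpr hchar.2.1)
      rw [annihilates_pow_two_pow_iff] at hhalf
      -- The square root does not depend on `j`, so one `γ` serves all the decimations by `2 ^ m`.
      obtain ⟨γ, hγ⟩ : ∃ γ : A, γ ^ 2 = β := by
        refine ⟨β ^ 2 ^ (G.R₂.length - 1), ?_⟩
        rw [← pow_mul, ← pow_succ, Nat.sub_add_cancel h₂.length_pos, ← hcard,
          FiniteField.pow_card]
      refine CCSG.not_pulses_gap_periodic h₁ (H := 2 ^ m) (by rw [hK, pow_succ'])
        (G.pulses_gap_of_pow_eq h₁ hα hord hgap (γ := γ) fun j => ?_)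
      refine eq_mul_sqrt_of_annihilates hφ0 hsurj hγ (hhalf j) (fun i => ?_) (fun i => ?_)
      · rw [← hout, pow_succ', mul_assoc]
      · rw [← hout, pow_succ', add_mul, one_mul, mul_assoc, add_assoc]
  · rw [hl, Nat.cast_succ, add_sub_cancel_right, zpow_natCast]
    exact_mod_cast hN
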